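/- \textbf{Theorem (application to monotone inclusion problems).} Let $H$ be a real Hilbert space, let $f:H\to H$ be a $k$-contraction ($\|f(u)-f(v)\|\le k\|u-v\|$ for all $u,v\in H$, with $k<1$), let $A:H\to H$ be $\eta$-inverse strongly monotone for some $\eta>0$ (that is, $\langle Au-Av,u-v\rangle\ge\eta\|Au-Av\|^2$ for all $u,v\in H$), and let $B:H\to 2^H$ be a maximal monotone operator such that $\Omega:=(A+B)^{-1}(0)=\{u\in H: 0\in Au+Bu\}\neq\emptyset$. For $r>0$ let $J_r^B=(I+rB)^{-1}:H\to H$ be the resolvent of $B$. Let $\{\lambda_n\}_{n\ge1}\subset(0,2\eta)$ with $\lambda_n\to\lambda$ for some $\lambda\in(0,2\eta)$, and put $T_n:=J^B_{\lambda_n}(I-\lambda_nA)$. Let $\theta\ge0$, $\{\varepsilon_n\}_{n\ge1}\subset(0,\infty)$ and $\{\alpha_n\}_{n\ge1},\{\beta_n\}_{n\ge1},\{\gamma_n\}_{n\ge1}\subset(0,1)$ be such that \begin{enumerate} \item[(1)] $0<a\le\alpha_n<a'<1$ for all $n\ge1$, for some real numbers $a,a'$, \item[(2)] $\lim_{n\to\infty}\varepsilon_n=0$,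 \item[(3)] $\lim_{n\to\infty}\gamma_n=0$ and $\sum_{n=1}^\infty\gamma_n=\infty$. \end{enumerate} Let $x_0,x_1\in H$ be arbitrary and let $\{x_n\}$ be generated, for $n\ge1$, by \[ \begin{aligned} z_n&=x_n+\theta_n(x_n-x_{n-1}),\\ y_n&=(1-\beta_n)z_n+\beta_nT_nz_n,\\ \omega_n&=T_n\big((1-\alpha_n)T_nx_n+\alpha_nT_ny_n\big),\\ x_{n+1}&=(1-\gamma_n)T_n\omega_n+\gamma_nf(\omega_n), \end{aligned} \] where $\theta_n=\min\{\theta,\ \varepsilon_n\gamma_n/\|x_n-x_{n-1}\|\}$ if $x_n\ne x_{n-1}$ and $\theta_n=\theta$ otherwise. Then $\{x_n\}$ converges strongly to a point $x^*\in\Omega$ with $x^*=P_\Omega f(x^*)$, where $P_\Omega$ is the metric projection of $H$ onto $\Omega$: for $u\in H$, $P_\Omega u$ is the unique point of $\Omega$ with $\|u-P_\Omega u\|\le\inf_{v\in\Omega}\|u-v\|$. -/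

import Mathlib

open Filter Topology

namespace MonotoneInclusion

variable {H : Type*} [NormedAddCommGroup H] [InnerProductSpace ℝ H]

/-- `A : H → H` is `η`-inverse strongly monotone. -/
def IsInverseStronglyMonotone (η : ℝ) (A : H → H) : Prop :=
  0 < η ∧ ∀ x y : H, η * ‖A x - A y‖ ^ 2 ≤ inner ℝ (A x - A y) (x - y)

/-- A set-valued operator `B : H → 2^H` is monotone. -/
def IsMonotoneOp (B : H → Set H) : Prop :=
  ∀ x y : H, ∀ z ∈ B x, ∀ w ∈ B y, 0 ≤ inner ℝ (z - w) (x - y)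

/-- The graph of a set-valued operator. -/
def opGraph (B : H → Set H) : Set (H × H) := {p | p.2 ∈ B p.1}

/-- `B` is maximal monotone: it is monotone and its graph is not properly contained in the
graph of any other monotone operator. -/
def IsMaximalMonotoneOp (B : H → Set H) : Prop :=
  IsMonotoneOp B ∧ ∀ B' : H → Set H, IsMonotoneOp B' → ¬ opGraph B ⊂ opGraph B'

/-- The set of zeros `M⁻¹(0)` of a set-valued operator `M`. -/
def zeros (M : H → Set H) : Set H := {x | 0 ∈ M x}

/-- The sum `A + B` of a single-valued and a set-valued operator. -/
def opAdd (A : H → H) (B : H → Set H) : H → Set H := fun x => {v | ∃ b ∈ B x, v = A x + b}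

/-- The set-valued operator `(I + r B)⁻¹`: it sends `x` to the set of all `y` with
`x ∈ y + r B y`. -/
def resolventSet (B : H → Set H) (r : ℝ) (x : H) : Set H := {y | ∃ b ∈ B y, x = y + r • b}

open Classical in
/-- The resolvent `J_r^B = (I + r B)⁻¹` as a map `H → H`. When `B` is maximal monotone on a Hilbert
space and `r > 0`, the set `resolventSet B r x` is a singleton for every `x`, and this is its
element; the value `0` is used only when that set is empty. -/
noncomputable def resolvent (B : H → Set H) (r : ℝ) (x : H) : H :=
  if h : (resolventSet B r x).Nonempty then h.some else 0

/-- The forward-backward operator `J_r^B (I - r A)`. -/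
noncomputable def forwardBackward (A : H → H) (B : H → Set H) (r : ℝ) (x : H) : H :=
  resolvent B r (x - r • A x)

open Classical in
/-- The inertial parameter: `min {θ, c / ‖u - v‖}` if `u ≠ v`, and `θ` otherwise. -/
noncomputable def inertialParam (θ c : ℝ) (u v : H) : ℝ :=
  if u ≠ v then min θ (c / ‖u - v‖) else θ

/-- `p = P_C x`: `p` is the unique point of `C` with `‖x - p‖ ≤ inf_{y ∈ C} ‖x - y‖`. -/
def IsMetricProjection (C : Set H) (x p : H) : Prop :=
  (p ∈ C ∧ ‖x - p‖ ≤ ⨅ y : C, ‖x - (y : H)‖) ∧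
    ∀ q ∈ C, ‖x - q‖ ≤ (⨅ y : C, ‖x - (y : H)‖) → q = p

end MonotoneInclusion

/-!
`T n` denotes the forward-backward operator of step `lam n`, `Ω` the zero set of `A + B`, and `p`
the fixed point of the contraction `P_Ω ∘ f`, so that `⟪f p - p, q - p⟫ ≤ 0` for `q ∈ Ω`.

*Minty's theorem* (`IsMaximalMonotoneOp.resolventSet_nonempty`) makes the resolvent meaningful. In a
Hilbert space it follows by minimising the Fitzpatrick function of `B` plus `‖·‖² / 2` over `H × H`:
this strongly convex problem has a solution `(x₀, u₀)`, and its optimality condition says that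
`(-u₀, -x₀)` is monotonically related to the graph of `B`. Maximality puts this point in the graph,
and the same inequality then gives `u₀ = -x₀`, that is `-x₀ ∈ B x₀`.

*The zero set* is an intersection of half-spaces, by Minty's trick
(`mem_zeros_opAdd_iff_forall`). This shows that `Ω` is closed and convex, and that a weak limit of
points `v n` with `v n - T n (v n) → 0` lies in `Ω` (`mem_zeros_of_tendsto_weak`).

*Convergence* (`tendsto_of_viscosity`). Put `v n = (1 - α n) T n (x n) + α n T n (y n)`, so
`ω n = T n (v n)`; the choice of the inertial parameter gives `‖v n - p‖ ≤ ‖x n - p‖ + ε n * γ n`.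
Together with the residual estimate `norm_forwardBackward_sub_sq_le`, the squared distance
`s n = ‖x n - p‖²` satisfies `s (n + 1) ≤ (1 - δ n) s n + δ n b n` with `δ n = (1 - k) γ n` and
`b n` equal to `2 ⟪f p - p, x (n + 1) - p⟫ / (1 - k)`, plus a null sequence, minus
`‖v n - ω n‖² / δ n` times a nonnegative coefficient with positive limit. If `b n > e > 0` for
infinitely many `n`, then the residual `‖v n - ω n‖²` is `O(δ n)` along these `n`, hence tends to
`0`. Along an ultrafilter containing them `x (n + 1)` has a weak limit in `Ω`, where the inner
product is nonpositive, contradicting `b n > e`. So `limsup b n ≤ 0`, and Xu's lemma yields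
`s n → 0`. Keeping the residual inside `b n` makes a case distinction on the monotonicity of `s`
unnecessary.
-/

namespace MonotoneInclusion

/-! ### Minty's theorem and the resolvent -/

/-- Existence of the proximal point at the origin of a closed convex function, with `E` in
the role of its epigraph. -/
theorem exists_minimizer_add_half_sq {V : Type*} [NormedAddCommGroup V] [InnerProductSpace ℝ V]
    [CompleteSpace V] {E : Set (V × ℝ)} (hne : E.Nonempty) (hconv : Convex ℝ E)
    (hcl : IsClosed E) {m₀ : ℝ} (hbdd : ∀ e ∈ E, m₀ ≤ e.2 + ‖e.1‖ ^ 2 / 2) :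
    ∃ e₀ ∈ E, ∀ e ∈ E, e₀.2 + ‖e₀.1‖ ^ 2 / 2 ≤ e.2 + ‖e.1‖ ^ 2 / 2 := by
  set F : V × ℝ → ℝ := fun e => e.2 + ‖e.1‖ ^ 2 / 2 with hF
  have hne' : (F '' E).Nonempty := hne.image F
  have hbb : BddBelow (F '' E) := ⟨m₀, by rintro _ ⟨e, he, rfl⟩; exact hbdd e he⟩
  set m := sInf (F '' E) with hm
  have hle : ∀ e ∈ E, m ≤ F e := fun e he => csInf_le hbb ⟨e, he, rfl⟩
  have hex : ∀ n : ℕ, ∃ e ∈ E, F e < m + 1 / ((n : ℝ) + 1) := by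
    intro n
    obtain ⟨_, ⟨e, he, rfl⟩, hlt⟩ :=
      exists_lt_of_csInf_lt hne' (lt_add_of_pos_right m (Nat.one_div_pos_of_nat (α := ℝ) (n := n)))
    exact ⟨e, he, hlt⟩
  choose e heE heF using hex
  have hFlim : Tendsto (fun n => F (e n)) atTop (𝓝 m) := by
    have h0 := (tendsto_one_div_add_atTop_nhds_zero_nat (𝕜 := ℝ)).const_add m
    rw [add_zero] at h0
    exact tendsto_of_tendsto_of_tendsto_of_le_of_le tendsto_const_nhds h0
      (fun n => hle _ (heE n)) (fun n => (heF n).le)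
  have hb0 : Tendsto (fun N : ℕ => √(8 * (1 / ((N : ℝ) + 1)))) atTop (𝓝 0) := by
    have h0 := ((tendsto_one_div_add_atTop_nhds_zero_nat (𝕜 := ℝ)).const_mul 8).sqrt
    simpa using h0
  -- The parallelogram law bounds the distance of two almost minimisers.
  have hcau : CauchySeq (fun n => (e n).1) := by
    refine cauchySeq_of_le_tendsto_0 _ (fun n l N hn hl => ?_) hb0
    apply Real.le_sqrt_of_sq_le
    rw [dist_eq_norm]
    have hmid : ((1 / 2 : ℝ) • e n + (1 / 2 : ℝ) • e l) ∈ E :=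
      hconv (heE n) (heE l) (by norm_num) (by norm_num) (by norm_num)
    have h1 := hle _ hmid
    have hx : ‖((1 / 2 : ℝ) • e n + (1 / 2 : ℝ) • e l).1‖ ^ 2 = ‖(e n).1 + (e l).1‖ ^ 2 / 4 := by
      rw [Prod.fst_add, Prod.smul_fst, Prod.smul_fst, ← smul_add, norm_smul, mul_pow]
      norm_num
      ring
    have hpar := parallelogram_law_with_norm ℝ (e n).1 (e l).1
    have h2 := heF n
    have h3 := heF l
    have h4 : 1 / ((n : ℝ) + 1) ≤ 1 / ((N : ℝ) + 1) := Nat.one_div_le_one_div hn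
    have h5 : 1 / ((l : ℝ) + 1) ≤ 1 / ((N : ℝ) + 1) := Nat.one_div_le_one_div hl
    simp only [hF, hx] at h1 h2 h3
    simp only [Prod.snd_add, Prod.smul_snd, smul_eq_mul] at h1
    nlinarith
  obtain ⟨p, hp⟩ := cauchySeq_tendsto_of_complete hcau
  have ht : Tendsto (fun n => (e n).2) atTop (𝓝 (m - ‖p‖ ^ 2 / 2)) := by
    have := hFlim.sub ((hp.norm.pow 2).div_const 2)
    simpa [hF] using this
  refine ⟨(p, m - ‖p‖ ^ 2 / 2), hcl.mem_of_tendsto (hp.prodMk_nhds ht)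
    (Eventually.of_forall heE), fun e' he' => ?_⟩
  have := hle e' he'
  simpa using this

/-- First-order optimality for `exists_minimizer_add_half_sq`, obtained by comparing the
minimiser with nearby points of the segment from it to `e`. -/
theorem exists_add_sq_le_add_inner {V : Type*} [NormedAddCommGroup V] [InnerProductSpace ℝ V]
    [CompleteSpace V] {E : Set (V × ℝ)} (hne : E.Nonempty) (hconv : Convex ℝ E)
    (hcl : IsClosed E) {m₀ : ℝ} (hbdd : ∀ e ∈ E, m₀ ≤ e.2 + ‖e.1‖ ^ 2 / 2) :
    ∃ e₀ ∈ E, ∀ e ∈ E, e₀.2 + ‖e₀.1‖ ^ 2 ≤ e.2 + inner ℝ e₀.1 e.1 := by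
  obtain ⟨e₀, he₀, hmin⟩ := exists_minimizer_add_half_sq hne hconv hcl hbdd
  refine ⟨e₀, he₀, fun e he => ?_⟩
  have key : ∀ τ ∈ Set.Ioo (0 : ℝ) 1,
      e₀.2 + ‖e₀.1‖ ^ 2 ≤ e.2 + inner ℝ e₀.1 e.1 + τ * (‖e.1 - e₀.1‖ ^ 2 / 2) := by
    intro τ hτ
    have h1 := hmin _ (hconv he₀ he (sub_nonneg.2 hτ.2.le) hτ.1.le (by ring))
    have h2 : ((1 - τ) • e₀ + τ • e).1 = e₀.1 + τ • (e.1 - e₀.1) := by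
      simp only [Prod.fst_add, Prod.smul_fst]; module
    rw [h2, norm_add_sq_real, norm_smul, inner_smul_right, inner_sub_right,
      real_inner_self_eq_norm_sq, mul_pow, Real.norm_eq_abs, sq_abs] at h1
    simp only [Prod.snd_add, Prod.smul_snd, smul_eq_mul] at h1
    have h3 : 0 ≤ τ * (e.2 + inner ℝ e₀.1 e.1 + τ * (‖e.1 - e₀.1‖ ^ 2 / 2)
        - (e₀.2 + ‖e₀.1‖ ^ 2)) := by nlinarith
    have := nonneg_of_mul_nonneg_right h3 hτ.1
    linarith
  have hlim : Tendsto (fun τ : ℝ => e.2 + inner ℝ e₀.1 e.1 + τ * (‖e.1 - e₀.1‖ ^ 2 / 2))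
      (𝓝[>] 0) (𝓝 (e.2 + inner ℝ e₀.1 e.1)) := by
    have : Continuous
        (fun τ : ℝ => e.2 + inner ℝ e₀.1 e.1 + τ * (‖e.1 - e₀.1‖ ^ 2 / 2)) := by fun_prop
    simpa using (this.tendsto 0).mono_left nhdsWithin_le_nhds
  refine ge_of_tendsto hlim ?_
  filter_upwards [Ioo_mem_nhdsGT (zero_lt_one' ℝ)] with τ hτ using key τ hτ

variable {H : Type*} [NormedAddCommGroup H] [InnerProductSpace ℝ H]

/-- A maximal monotone operator contains every point monotonically related to its graph. -/
theorem IsMaximalMonotoneOp.mem_of_forall {B : H → Set H} (hB : IsMaximalMonotoneOp B) {x u : H}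
    (h : ∀ y, ∀ b ∈ B y, 0 ≤ inner ℝ (u - b) (x - y)) : u ∈ B x := by
  by_contra hu
  refine hB.2 (fun y => B y ∪ {v | y = x ∧ v = u}) ?_ ?_
  · rintro y y' v (hv | ⟨rfl, rfl⟩) v' (hv' | ⟨rfl, rfl⟩)
    · exact hB.1 y y' v hv v' hv'
    · have := h y v hv
      rwa [← neg_sub, ← neg_sub y' y, inner_neg_neg]
    · exact h y' v' hv'
    · simp
  · refine ⟨fun p hp => Or.inl hp, fun hsub => hu ?_⟩
    exact hsub (a := (x, u)) (Or.inr ⟨rfl, rfl⟩)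

/-- The core of Minty's theorem. The minimiser `(x₀, u₀)` of the Fitzpatrick function plus
`‖·‖² / 2` is such that `(-u₀, -x₀)` is monotonically related to the graph. -/
theorem exists_neg_mem [CompleteSpace H] {B : H → Set H} (hmono : IsMonotoneOp B)
    (hmax : ∀ x u, (∀ y, ∀ b ∈ B y, 0 ≤ inner ℝ (u - b) (x - y)) → u ∈ B x) :
    ∃ x, -x ∈ B x := by
  -- The epigraph of the Fitzpatrick function of `B`.
  set E : Set (WithLp 2 (H × H) × ℝ) :=
    {e | ∀ y, ∀ b ∈ B y, inner ℝ e.1.fst b + inner ℝ y e.1.snd - inner ℝ y b ≤ e.2} with hE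
  have hgraph : ∀ y, ∀ b ∈ B y,
      ((WithLp.toLp 2 (y, b), inner ℝ y b) : WithLp 2 (H × H) × ℝ) ∈ E := by
    intro y b hb y' b' hb'
    have := hmono y y' b hb b' hb'
    simp only [inner_sub_left, inner_sub_right] at this
    change inner ℝ y b' + inner ℝ y' b - inner ℝ y' b' ≤ inner ℝ y b
    rw [real_inner_comm y b, real_inner_comm y' b, real_inner_comm y b', real_inner_comm y' b'] at *
    linarith
  have hBne : ∃ y b, b ∈ B y := by
    by_contra! h
    exact h 0 0 (hmax 0 0 fun y b hb => absurd hb (h y b))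
  have hne : E.Nonempty := by
    obtain ⟨y, b, hb⟩ := hBne
    exact ⟨_, hgraph y b hb⟩
  have hconv : Convex ℝ E := by
    intro e he e' he' s t hs ht hst y b hb
    have h1 := mul_le_mul_of_nonneg_left (he y b hb) hs
    have h2 := mul_le_mul_of_nonneg_left (he' y b hb) ht
    simp only [Prod.fst_add, Prod.smul_fst, Prod.snd_add, Prod.smul_snd, WithLp.add_fst,
      WithLp.add_snd, WithLp.smul_fst, WithLp.smul_snd, inner_add_left, inner_add_right,
      real_inner_smul_left, real_inner_smul_right, smul_eq_mul]
    have : inner ℝ y b = s * inner ℝ y b + t * inner ℝ y b := by rw [← add_mul, hst, one_mul]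
    linarith
  have hcl : IsClosed E := by
    have : E = ⋂ y, ⋂ b ∈ B y, {e : WithLp 2 (H × H) × ℝ |
        inner ℝ e.1.fst b + inner ℝ y e.1.snd - inner ℝ y b ≤ e.2} := by
      ext e; simp [hE]
    rw [this]
    refine isClosed_iInter fun y => isClosed_biInter fun b _ => isClosed_le ?_ (by fun_prop)
    fun_prop
  -- By maximality the Fitzpatrick function dominates the duality pairing.
  have hpair : ∀ e ∈ E, inner ℝ e.1.fst e.1.snd ≤ e.2 := by
    intro e he
    by_cases hmem : e.1.snd ∈ B e.1.fst
    · have := he _ _ hmem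
      linarith
    · have : ∃ y, ∃ b ∈ B y, inner ℝ (e.1.snd - b) (e.1.fst - y) < 0 := by
        by_contra! h
        exact hmem (hmax _ _ h)
      obtain ⟨y, b, hb, hlt⟩ := this
      have h1 := he y b hb
      simp only [inner_sub_left, inner_sub_right] at hlt
      rw [real_inner_comm e.1.fst e.1.snd, real_inner_comm y e.1.snd, real_inner_comm e.1.fst b,
        real_inner_comm y b] at hlt
      linarith
  obtain ⟨e₀, he₀, hvar⟩ := exists_add_sq_le_add_inner (m₀ := 0) hne hconv hcl (by
    intro e he
    have h1 := hpair e he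
    have h2 := WithLp.prod_norm_sq_eq_of_L2 e.1
    have h3 : 0 ≤ ‖e.1.fst + e.1.snd‖ ^ 2 := sq_nonneg _
    rw [norm_add_sq_real] at h3
    linarith)
  have hrel : ∀ y, ∀ b ∈ B y,
      ‖e₀.1.fst + e₀.1.snd‖ ^ 2 ≤ inner ℝ (-e₀.1.fst - b) (-e₀.1.snd - y) := by
    intro y b hb
    have h1 := hvar _ (hgraph y b hb)
    have h2 := hpair e₀ he₀
    rw [WithLp.prod_norm_sq_eq_of_L2, WithLp.prod_inner_apply] at h1
    change _ ≤ inner ℝ y b + (inner ℝ e₀.1.fst y + inner ℝ e₀.1.snd b) at h1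
    rw [norm_add_sq_real]
    simp only [inner_sub_left, inner_sub_right, inner_neg_left, inner_neg_right]
    rw [real_inner_comm e₀.1.snd b, real_inner_comm y b]
    linarith
  have hmem : -e₀.1.fst ∈ B (-e₀.1.snd) :=
    hmax _ _ fun y b hb => (sq_nonneg _).trans (hrel y b hb)
  have hzero := hrel _ _ hmem
  simp only [sub_self, inner_zero_left] at hzero
  have hsum : e₀.1.fst + e₀.1.snd = 0 := by
    rw [← norm_eq_zero]
    exact pow_eq_zero_iff two_ne_zero |>.1 (le_antisymm hzero (sq_nonneg _))
  refine ⟨e₀.1.fst, ?_⟩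
  rwa [← eq_neg_of_add_eq_zero_left hsum] at hmem

/-- Minty's theorem: `I + rB` is surjective. -/
theorem IsMaximalMonotoneOp.resolventSet_nonempty [CompleteSpace H] {B : H → Set H}
    (hB : IsMaximalMonotoneOp B) {r : ℝ} (hr : 0 < r) (x : H) : (resolventSet B r x).Nonempty := by
  -- Apply the core case to the maximal monotone operator `rB - x`.
  obtain ⟨y, b, hb, hy⟩ := exists_neg_mem (B := fun y => {v | ∃ b ∈ B y, v = r • b - x}) (by
      rintro y y' _ ⟨b, hb, rfl⟩ _ ⟨b', hb', rfl⟩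
      rw [sub_sub_sub_cancel_right, ← smul_sub, real_inner_smul_left]
      exact mul_nonneg hr.le (hB.1 y y' b hb b' hb')) (by
      intro y v h
      refine ⟨r⁻¹ • (v + x), hB.mem_of_forall fun y' b hb => ?_, ?_⟩
      · have h1 := h y' _ ⟨b, hb, rfl⟩
        have h2 : r⁻¹ • (v + x) - b = r⁻¹ • (v - (r • b - x)) := by
          rw [← sub_eq_zero]
          simp only [smul_sub, smul_add, inv_smul_smul₀ hr.ne']
          abel
        rw [h2, real_inner_smul_left]
        exact mul_nonneg (inv_nonneg.2 hr.le) h1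
      · rw [smul_inv_smul₀ hr.ne']; abel)
  exact ⟨y, b, hb, by linear_combination (norm := module) hy⟩

theorem IsMaximalMonotoneOp.resolvent_mem [CompleteSpace H] {B : H → Set H}
    (hB : IsMaximalMonotoneOp B) {r : ℝ} (hr : 0 < r) (x : H) :
    ∃ b ∈ B (resolvent B r x), x = resolvent B r x + r • b := by
  have h := hB.resolventSet_nonempty hr x
  rw [resolvent, dif_pos h]
  exact h.some_mem

/-! ### Zeros of `A + B` and the forward-backward operator -/

theorem mem_zeros_opAdd {G : Type*} [NormedAddCommGroup G] {A : G → G} {B : G → Set G}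
    {p : G} :
    p ∈ zeros (opAdd A B) ↔ -A p ∈ B p := by
  constructor
  · rintro ⟨b, hb, h⟩
    rwa [← eq_neg_of_add_eq_zero_right h.symm]
  · intro h
    exact ⟨_, h, (add_neg_cancel _).symm⟩

theorem IsInverseStronglyMonotone.norm_sub_le {η : ℝ} {A : H → H}
    (hA : IsInverseStronglyMonotone η A) (u v : H) : ‖A u - A v‖ ≤ η⁻¹ * ‖u - v‖ := by
  rw [le_inv_mul_iff₀ hA.1]
  rcases (norm_nonneg (A u - A v)).eq_or_lt with h | h
  · rw [← h, mul_zero]; exact norm_nonneg _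
  · refine le_of_mul_le_mul_right ?_ h
    have := (hA.2 u v).trans (real_inner_le_norm _ _)
    linarith

/-- Minty's description of the zeros of `A + B`: a point is a zero as soon as it solves the dual
variational inequality. The right-hand side is an intersection of closed half-spaces in `q`, and
involves `q` only through inner products with fixed vectors. -/
theorem mem_zeros_opAdd_iff_forall [CompleteSpace H] {η : ℝ} {A : H → H} {B : H → Set H}
    (hA : IsInverseStronglyMonotone η A) (hB : IsMaximalMonotoneOp B) {q : H} :
    q ∈ zeros (opAdd A B) ↔ ∀ y, ∀ b ∈ B y, 0 ≤ inner ℝ (A y + b) (y - q) := by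
  have hη := hA.1
  rw [mem_zeros_opAdd]
  constructor
  · intro hq y b hb
    have h1 := hB.1 y q b hb _ hq
    have h2 := (mul_nonneg hη.le (sq_nonneg _)).trans (hA.2 y q)
    have h3 : A y + b = (A y - A q) + (b - -A q) := by abel
    rw [h3, inner_add_left]
    exact add_nonneg h2 h1
  · intro h
    -- Test the inequality at the image of `q` under the forward-backward step of length `η / 2`,
    -- for which `(η / 2) • A` is a strict contraction.
    obtain ⟨b, hb, hq⟩ := hB.resolvent_mem (half_pos hη) (q - (η / 2) • A q)
    set y := resolvent B (η / 2) (q - (η / 2) • A q)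
    have h1 : (η / 2) • (A y + b) = (η / 2) • (A y - A q) - (y - q) := by
      linear_combination (norm := module) -hq
    have h2 := mul_nonneg (half_pos hη).le (h y b hb)
    rw [← real_inner_smul_left, h1, inner_sub_left, real_inner_smul_left,
      real_inner_self_eq_norm_sq] at h2
    have h3 := (real_inner_le_norm (A y - A q) (y - q)).trans
      (mul_le_mul_of_nonneg_right (hA.norm_sub_le y q) (norm_nonneg _))
    have h4 := mul_le_mul_of_nonneg_left h3 (half_pos hη).le
    have h5 : η / 2 * (η⁻¹ * ‖y - q‖ * ‖y - q‖) = ‖y - q‖ ^ 2 / 2 := by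
      field_simp
    have h6 : ‖y - q‖ ^ 2 = 0 := le_antisymm (by linarith) (sq_nonneg _)
    have h7 : y = q := by simpa [sub_eq_zero] using h6
    rw [h7] at hb hq
    have h8 : (η / 2) • b = (η / 2) • (-A q) := by
      linear_combination (norm := module) -hq
    rwa [smul_right_injective H (half_pos hη).ne' h8] at hb

theorem convex_zeros_opAdd [CompleteSpace H] {η : ℝ} {A : H → H} {B : H → Set H}
    (hA : IsInverseStronglyMonotone η A) (hB : IsMaximalMonotoneOp B) :
    Convex ℝ (zeros (opAdd A B)) := by
  intro q hq q' hq' s t hs ht hst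
  rw [mem_zeros_opAdd_iff_forall hA hB] at *
  intro y b hb
  have h : y - (s • q + t • q') = s • (y - q) + t • (y - q') := by
    linear_combination (norm := module) -hst • y
  rw [h, inner_add_right, real_inner_smul_right, real_inner_smul_right]
  exact add_nonneg (mul_nonneg hs (hq y b hb)) (mul_nonneg ht (hq' y b hb))

theorem isClosed_zeros_opAdd [CompleteSpace H] {η : ℝ} {A : H → H} {B : H → Set H}
    (hA : IsInverseStronglyMonotone η A) (hB : IsMaximalMonotoneOp B) :
    IsClosed (zeros (opAdd A B)) := by
  have h : zeros (opAdd A B) = ⋂ y, ⋂ b ∈ B y, {q | 0 ≤ inner ℝ (A y + b) (y - q)} := by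
    ext q
    simp [mem_zeros_opAdd_iff_forall hA hB]
  rw [h]
  exact isClosed_iInter fun y => isClosed_biInter fun b _ =>
    isClosed_le continuous_const (by fun_prop)

theorem forwardBackward_mem [CompleteSpace H] {A : H → H} {B : H → Set H}
    (hB : IsMaximalMonotoneOp B) {r : ℝ} (hr : 0 < r) (v : H) :
    r⁻¹ • (v - forwardBackward A B r v) - A v ∈ B (forwardBackward A B r v) := by
  obtain ⟨b, hb, h⟩ := hB.resolvent_mem hr (v - r • A v)
  change b ∈ B (forwardBackward A B r v) at hb
  change _ = forwardBackward A B r v + r • b at h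
  have h1 : v - forwardBackward A B r v = r • (A v + b) := by
    linear_combination (norm := module) h
  rwa [h1, inv_smul_smul₀ hr.ne', add_sub_cancel_left]

/-- `I - forwardBackward A B r` controls the decrease of distances. The estimate combines
firm nonexpansiveness of the resolvent with inverse strong monotonicity of `A`. -/
theorem norm_forwardBackward_sub_sq_le [CompleteSpace H] {η : ℝ} {A : H → H} {B : H → Set H}
    (hA : IsInverseStronglyMonotone η A) (hB : IsMaximalMonotoneOp B) {r : ℝ} (hr : 0 < r)
    (hr' : r < 2 * η) (u v : H) :
    ‖forwardBackward A B r u - forwardBackward A B r v‖ ^ 2 ≤ ‖u - v‖ ^ 2 -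
      (2 * η - r) / (4 * η) *
        ‖(u - forwardBackward A B r u) - (v - forwardBackward A B r v)‖ ^ 2 := by
  have hη := hA.1
  have hmono := hB.1 _ _ _ (forwardBackward_mem (A := A) hB hr u) _
    (forwardBackward_mem (A := A) hB hr v)
  set Tu := forwardBackward A B r u
  set Tv := forwardBackward A B r v
  set d := (u - Tu) - (v - Tv) with hd
  set g := A u - A v with hg
  set w := u - v with hw
  have hT : Tu - Tv = w - d := by rw [hw, hd]; abel
  have hgoc : η * ‖g‖ ^ 2 ≤ inner ℝ g w := hA.2 u v
  have h1 : r⁻¹ • (u - Tu) - A u - (r⁻¹ • (v - Tv) - A v) = r⁻¹ • (d - r • g) := by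
    rw [smul_sub r⁻¹ d, inv_smul_smul₀ hr.ne', hd, hg, smul_sub r⁻¹ (u - Tu)]; abel
  rw [h1, hT, real_inner_smul_left] at hmono
  have h2 : 0 ≤ inner ℝ (d - r • g) (w - d) := nonneg_of_mul_nonneg_right hmono (inv_pos.2 hr)
  simp only [inner_sub_left, inner_sub_right, real_inner_smul_left,
    real_inner_self_eq_norm_sq] at h2
  -- Completing the square in `g` absorbs the cross term `2r⟪g, d⟫`.
  have h3 : 0 ≤ ‖(2 * η) • g - d‖ ^ 2 := sq_nonneg _
  rw [norm_sub_sq_real, norm_smul, real_inner_smul_left, mul_pow, Real.norm_eq_abs, sq_abs] at h3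
  rw [hT, norm_sub_sq_real, real_inner_comm]
  have h4 : (2 * η - r) / (4 * η) * ‖d‖ ^ 2 = ‖d‖ ^ 2 / 2 - r / (4 * η) * ‖d‖ ^ 2 := by
    field_simp; ring
  have h5 : 0 ≤ r / (2 * η) *
      ((2 * η) ^ 2 * ‖g‖ ^ 2 - 2 * (2 * η * inner ℝ g d) + ‖d‖ ^ 2) := by positivity
  have h6 : r / (2 * η) * ((2 * η) ^ 2 * ‖g‖ ^ 2 - 2 * (2 * η * inner ℝ g d) + ‖d‖ ^ 2)
      = 2 * r * (η * ‖g‖ ^ 2) - 2 * r * inner ℝ g d + r / (4 * η) * ‖d‖ ^ 2 * 2 := by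
    field_simp; ring
  have h7 := mul_le_mul_of_nonneg_left hgoc (mul_pos two_pos hr).le
  have h8 : r / (4 * η) * ‖d‖ ^ 2 ≤ ‖d‖ ^ 2 / 2 := by
    rw [← sub_nonneg, ← h4]
    exact mul_nonneg (div_nonneg (by linarith) (by linarith)) (sq_nonneg _)
  nlinarith

theorem norm_forwardBackward_sub_le [CompleteSpace H] {η : ℝ} {A : H → H} {B : H → Set H}
    (hA : IsInverseStronglyMonotone η A) (hB : IsMaximalMonotoneOp B) {r : ℝ} (hr : 0 < r)
    (hr' : r < 2 * η) (u v : H) :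
    ‖forwardBackward A B r u - forwardBackward A B r v‖ ≤ ‖u - v‖ := by
  refine le_of_sq_le_sq ?_ (norm_nonneg _)
  have hη := hA.1
  refine (norm_forwardBackward_sub_sq_le hA hB hr hr' u v).trans (sub_le_self _ ?_)
  exact mul_nonneg (div_nonneg (by linarith) (by linarith)) (sq_nonneg _)

theorem forwardBackward_eq_self [CompleteSpace H] {A : H → H} {B : H → Set H}
    (hB : IsMaximalMonotoneOp B) {r : ℝ} (hr : 0 < r) {p : H} (hp : p ∈ zeros (opAdd A B)) :
    forwardBackward A B r p = p := by
  have h := hB.1 _ _ _ (forwardBackward_mem (A := A) hB hr p) _ (mem_zeros_opAdd.1 hp)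
  have h1 : r⁻¹ • (p - forwardBackward A B r p) - A p - -A p
      = r⁻¹ • -(forwardBackward A B r p - p) := by
    rw [neg_sub]; abel
  rw [h1, real_inner_smul_left, inner_neg_left, real_inner_self_eq_norm_sq] at h
  have h2 := nonneg_of_mul_nonneg_right h (inv_pos.2 hr)
  have h3 : ‖forwardBackward A B r p - p‖ ^ 2 = 0 := le_antisymm (by linarith) (sq_nonneg _)
  simpa [sub_eq_zero] using h3

/-- Demiclosedness with varying step lengths, along an arbitrary filter. -/
theorem mem_zeros_of_tendsto_weak [CompleteSpace H] {η : ℝ} {A : H → H} {B : H → Set H}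
    (hA : IsInverseStronglyMonotone η A) (hB : IsMaximalMonotoneOp B) {ι : Type*} {l : Filter ι}
    [l.NeBot] {r : ι → ℝ} {r' : ℝ} (hr : ∀ᶠ n in l, 0 < r n) (hr' : 0 < r')
    (hlim : Tendsto r l (𝓝 r')) {v : ι → H} {q : H} {C : ℝ} (hC : ∀ᶠ n in l, ‖v n‖ ≤ C)
    (hweak : ∀ h, Tendsto (fun n => inner ℝ h (v n)) l (𝓝 (inner ℝ h q)))
    (hres : Tendsto (fun n => v n - forwardBackward A B (r n) (v n)) l (𝓝 0)) :
    q ∈ zeros (opAdd A B) := by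
  rw [mem_zeros_opAdd_iff_forall hA hB]
  intro y b hb
  set d := fun n => v n - forwardBackward A B (r n) (v n) with hd
  set g := fun n => (r n)⁻¹ • d n + (A (forwardBackward A B (r n) (v n)) - A (v n)) with hg
  have hAlim : Tendsto (fun n => A (forwardBackward A B (r n) (v n)) - A (v n)) l (𝓝 0) := by
    refine squeeze_zero_norm (a := fun n => η⁻¹ * ‖d n‖) (fun n => ?_) ?_
    · rw [hd, norm_sub_rev (v n)]
      exact hA.norm_sub_le _ _
    · simpa using hres.norm.const_mul η⁻¹
  have hglim : Tendsto g l (𝓝 0) := by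
    simpa using ((hlim.inv₀ hr'.ne').smul hres).add hAlim
  have h1 : ∀ᶠ n in l, 0 ≤ inner ℝ (g n) (v n - d n - y)
      + inner ℝ (A y + b) (d n) + (inner ℝ (A y + b) y - inner ℝ (A y + b) (v n)) := by
    filter_upwards [hr] with n hn
    set w := forwardBackward A B (r n) (v n) with hw
    have hm := hB.1 _ _ _ (forwardBackward_mem (A := A) hB hn (v n)) _ hb
    have hm' := (mul_nonneg hA.1.le (sq_nonneg _)).trans (hA.2 w y)
    have hdw : v n - d n = w := by simp [hd, hw]
    have hsum := add_nonneg hm hm'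
    rw [← inner_add_left] at hsum
    have he : (r n)⁻¹ • (v n - w) - A (v n) - b + (A w - A y) = g n - (A y + b) := by
      simp only [hg, hd, ← hw]; abel
    have he' : inner ℝ (A y + b) (w - y) = inner ℝ (A y + b) (v n) - inner ℝ (A y + b) (d n)
        - inner ℝ (A y + b) y := by
      rw [← hdw, inner_sub_right, inner_sub_right]
    rw [he, inner_sub_left, he'] at hsum
    rw [hdw]
    linarith
  have h2 : Tendsto (fun n => inner ℝ (g n) (v n - d n - y)) l (𝓝 0) := by
    refine squeeze_zero_norm' (a := fun n => ‖g n‖ * (C + ‖d n‖ + ‖y‖)) ?_ ?_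
    · filter_upwards [hC] with n hn
      refine (norm_inner_le_norm _ _).trans (mul_le_mul_of_nonneg_left ?_ (norm_nonneg _))
      refine (norm_sub_le _ _).trans (add_le_add_left ((norm_sub_le _ _).trans ?_) _)
      exact add_le_add_left hn _
    · simpa using hglim.norm.mul ((hres.norm.const_add C).add_const ‖y‖)
  have h3 : Tendsto (fun n => inner ℝ (A y + b) (d n)) l (𝓝 0) := by
    simpa using (tendsto_const_nhds (x := A y + b)).inner hres (𝕜 := ℝ)
  have h4 := (h2.add h3).add ((hweak (A y + b)).const_sub (inner ℝ (A y + b) y))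
  rw [zero_add, zero_add, ← inner_sub_right] at h4
  exact ge_of_tendsto h4 h1

/-! ### A recursive inequality -/

/-- Xu's lemma on real recurrences, with the hypothesis `limsup b ≤ 0` written out, so that
`b` may be unbounded below. -/
theorem tendsto_zero_of_le_one_sub_mul_add {s δ b : ℕ → ℝ} (hs : ∀ n, 0 ≤ s n)
    (hδ : ∀ n, 1 ≤ n → δ n ∈ Set.Icc 0 1)
    (hsum : Tendsto (fun N : ℕ => ∑ n ∈ Finset.Icc 1 N, δ n) atTop atTop)
    (hrec : ∀ n, 1 ≤ n → s (n + 1) ≤ (1 - δ n) * s n + δ n * b n)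
    (hb : ∀ e, 0 < e → ∀ᶠ n in atTop, b n ≤ e) : Tendsto s atTop (𝓝 0) := by
  set S : ℕ → ℝ := fun N => ∑ n ∈ Finset.Icc 1 N, δ n with hS
  rw [Metric.tendsto_atTop']
  intro e he
  obtain ⟨N, hN⟩ := eventually_atTop.1 (hb (e / 2) (half_pos he))
  have hclaim : ∀ n, N ≤ n → s (n + 1) - e / 2 ≤ Real.exp (S N - S n) * s (N + 1) := by
    intro n hn
    induction n, hn using Nat.le_induction with
    | base => simpa using (half_pos he).le
    | succ n hn ih =>
      have hδn := hδ (n + 1) (by omega)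
      have h1 := hrec (n + 1) (by omega)
      have h2 := mul_le_mul_of_nonneg_left (hN (n + 1) (by omega)) hδn.1
      have h3 := mul_le_mul_of_nonneg_left ih (sub_nonneg.2 hδn.2)
      have h4 : Real.exp (S N - S (n + 1)) = Real.exp (-δ (n + 1)) * Real.exp (S N - S n) := by
        rw [← Real.exp_add]
        congr 1
        simp only [hS, Finset.sum_Icc_succ_top (Nat.succ_le_succ (Nat.zero_le n))]
        ring
      have h5 : (1 - δ (n + 1)) * (Real.exp (S N - S n) * s (N + 1))
          ≤ Real.exp (-δ (n + 1)) * (Real.exp (S N - S n) * s (N + 1)) :=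
        mul_le_mul_of_nonneg_right (Real.one_sub_le_exp_neg _)
          (mul_nonneg (Real.exp_pos _).le (hs _))
      rw [h4, mul_assoc]
      linarith
  have hexp : Tendsto (fun n => Real.exp (S N - S n) * s (N + 1)) atTop (𝓝 0) := by
    have h1 : Tendsto (fun n => S N - S n) atTop atBot :=
      tendsto_const_nhds.add_atBot (tendsto_neg_atTop_atBot.comp hsum)
    simpa using (Real.tendsto_exp_atBot.comp h1).mul_const (s (N + 1))
  obtain ⟨M, hM⟩ := eventually_atTop.1 (hexp.eventually (gt_mem_nhds (half_pos he)))
  refine ⟨max N M + 1, fun n hn => ?_⟩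
  obtain ⟨j, rfl⟩ : ∃ j, n = j + 1 := ⟨n - 1, by omega⟩
  rw [Real.dist_0_eq_abs, abs_of_nonneg (hs _)]
  have h1 := hclaim j (by omega)
  have h2 := hM j (by omega)
  linarith

/-! ### Viscosity approximation -/

/-- Weak compactness of bounded sets, in terms of ultrafilters. -/
theorem exists_tendsto_inner_ultrafilter [CompleteSpace H] {ι : Type*} (U : Ultrafilter ι)
    {v : ι → H} {C : ℝ} (hC : ∀ᶠ n in (U : Filter ι), ‖v n‖ ≤ C) :
    ∃ q, ∀ h, Tendsto (fun n => inner ℝ h (v n)) U (𝓝 (inner ℝ h q)) := by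
  set φ : ι → WeakDual ℝ H := fun n => StrongDual.toWeakDual (InnerProductSpace.toDual ℝ H (v n))
    with hφ
  have hmem : ∀ᶠ n in (U : Filter ι),
      φ n ∈ WeakDual.toStrongDual ⁻¹' Metric.closedBall (0 : StrongDual ℝ H) C := by
    filter_upwards [hC] with n hn
    simpa [hφ] using hn
  obtain ⟨ψ, -, hψ⟩ := (WeakDual.isCompact_closedBall (𝕜 := ℝ) (0 : StrongDual ℝ H) C)
    |>.ultrafilter_le_nhds (U.map φ) (le_principal_iff.2 hmem)
  refine ⟨(InnerProductSpace.toDual ℝ H).symm (WeakDual.toStrongDual ψ), fun h => ?_⟩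
  have h1 : Tendsto φ U (𝓝 ψ) := hψ
  have h2 := ((WeakDual.eval_continuous h).tendsto ψ).comp h1
  rw [real_inner_comm, InnerProductSpace.toDual_symm_apply]
  refine h2.congr fun n => ?_
  simp [hφ, real_inner_comm]

/-- Banach's fixed point theorem for `P_Ω ∘ f`, together with the variational inequality that
characterises the projection. -/
theorem exists_isMetricProjection_fixed [CompleteSpace H] {f : H → H} {k : NNReal}
    (hf : ContractingWith k f) {Ω : Set H} (hne : Ω.Nonempty) (hconv : Convex ℝ Ω)
    (hcl : IsClosed Ω) :
    ∃ p ∈ Ω, IsMetricProjection Ω (f p) p ∧ ∀ q ∈ Ω, inner ℝ (f p - p) (q - p) ≤ 0 := by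
  choose P hPmem hP using exists_norm_eq_iInf_of_complete_convex hne hcl.isComplete hconv
  have hvar : ∀ u, ∀ q ∈ Ω, inner ℝ (u - P u) (q - P u) ≤ 0 := fun u =>
    (norm_eq_iInf_iff_real_inner_le_zero hconv (hPmem u)).1 (hP u)
  have hPne : ∀ u v, ‖P u - P v‖ ≤ ‖u - v‖ := by
    intro u v
    have h1 := hvar u _ (hPmem v)
    have h2 := hvar v _ (hPmem u)
    have h3 : ‖P u - P v‖ * ‖P u - P v‖ ≤ inner ℝ (u - v) (P u - P v) := by
      rw [← real_inner_self_eq_norm_mul_norm]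
      rw [← neg_sub (P u) (P v), inner_neg_right] at h1
      have h4 : inner ℝ (u - v) (P u - P v) - inner ℝ (P u - P v) (P u - P v)
          = inner ℝ (u - P u) (P u - P v) - inner ℝ (v - P v) (P u - P v) := by
        simp only [← inner_sub_left]; congr 1; abel
      linarith
    rcases (norm_nonneg (P u - P v)).eq_or_lt with h | h
    · rw [← h]; exact norm_nonneg _
    · exact le_of_mul_le_mul_right (h3.trans (real_inner_le_norm _ _)) h
  have hPf : ContractingWith k (P ∘ f) := by
    refine ⟨hf.1, LipschitzWith.of_dist_le_mul fun u v => ?_⟩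
    have := hf.2.dist_le_mul u v
    simp only [dist_eq_norm, Function.comp_apply] at *
    exact (hPne _ _).trans this
  obtain ⟨p, hp⟩ : ∃ p, P (f p) = p := ⟨_, hPf.fixedPoint_isFixedPt⟩
  have hpΩ : p ∈ Ω := hp ▸ hPmem (f p)
  have hvarp : ∀ q ∈ Ω, inner ℝ (f p - p) (q - p) ≤ 0 := by
    have := hvar (f p)
    rwa [hp] at this
  refine ⟨p, hpΩ, ⟨⟨hpΩ, ?_⟩, fun q hq hle => ?_⟩, hvarp⟩
  · have := hP (f p)
    rw [hp] at this
    exact this.le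
  · have h1 : ‖f p - q‖ = ⨅ w : Ω, ‖f p - w‖ :=
      le_antisymm hle (ciInf_le ⟨0, by rintro _ ⟨w, rfl⟩; exact norm_nonneg _⟩ (⟨q, hq⟩ : Ω))
    have h2 := (norm_eq_iInf_iff_real_inner_le_zero hconv hq).1 h1 p hpΩ
    have h3 := hvarp q hq
    have h4 : ‖q - p‖ ^ 2 = inner ℝ (f p - p) (q - p) + inner ℝ (f p - q) (p - q) := by
      rw [← neg_sub q p, inner_neg_right, ← sub_eq_add_neg, ← inner_sub_left,
        sub_sub_sub_cancel_left, real_inner_self_eq_norm_sq]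
    have h5 : ‖q - p‖ ^ 2 = 0 := le_antisymm (by linarith) (sq_nonneg _)
    simpa [sub_eq_zero] using h5

theorem norm_inertialParam_smul_le {θ c : ℝ} (hθ : 0 ≤ θ) (hc : 0 ≤ c) (u v : H) :
    ‖inertialParam θ c u v • (u - v)‖ ≤ c := by
  by_cases h : u = v
  · simpa [h] using hc
  · have hpos : 0 < ‖u - v‖ := norm_pos_iff.2 (sub_ne_zero.2 h)
    rw [inertialParam, if_pos h, norm_smul, Real.norm_eq_abs,
      abs_of_nonneg (le_min hθ (div_nonneg hc hpos.le)), ← le_div_iff₀ hpos]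
    exact min_le_right _ _

/-- One viscosity step `(1 - γ) u + γ f w`, measured from `p`, with the drift term
`⟪f p - p, ·⟫` kept separate. -/
theorem norm_viscosity_sub_sq_le {f : H → H} {k : NNReal} (hf : ContractingWith k f) {γ : ℝ}
    (hγ : γ ∈ Set.Ioo (0 : ℝ) 1) {p u w x' : H} (huw : ‖u - p‖ ≤ ‖w - p‖)
    (hx' : x' = (1 - γ) • u + γ • f w) :
    ‖x' - p‖ ^ 2 ≤ (1 - (1 - k) * γ) * ‖w - p‖ ^ 2 + 2 * γ * inner ℝ (f p - p) (x' - p) := by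
  have hk : (k : ℝ) < 1 := hf.1
  have hk0 : (0 : ℝ) ≤ k := k.2
  set a := (1 - γ) • (u - p) + γ • (f w - f p) with ha
  have h1 : x' - p = a + γ • (f p - p) := by rw [hx', ha]; module
  have h2 : ‖a‖ ≤ (1 - (1 - k) * γ) * ‖w - p‖ := by
    have hfw := hf.2.dist_le_mul w p
    rw [dist_eq_norm, dist_eq_norm] at hfw
    refine (norm_add_le _ _).trans ?_
    rw [norm_smul, norm_smul, Real.norm_of_nonneg (sub_nonneg.2 hγ.2.le),
      Real.norm_of_nonneg hγ.1.le]
    have h3 := mul_le_mul_of_nonneg_left huw (sub_nonneg.2 hγ.2.le)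
    have h4 := mul_le_mul_of_nonneg_left hfw hγ.1.le
    linarith
  have hδ0 : 0 ≤ 1 - (1 - k) * γ := by nlinarith [hγ.1, hγ.2]
  have hδ1 : 1 - (1 - k) * γ ≤ 1 := by nlinarith [hγ.1, hγ.2]
  have h5 : ‖a‖ ^ 2 ≤ (1 - (1 - k) * γ) * ‖w - p‖ ^ 2 := by
    refine (pow_le_pow_left₀ (norm_nonneg _) h2 2).trans ?_
    rw [mul_pow]
    exact mul_le_mul_of_nonneg_right (pow_le_of_le_one hδ0 hδ1 two_ne_zero) (sq_nonneg _)
  have h6 : a = (x' - p) - γ • (f p - p) := by rw [h1]; abel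
  rw [h6, norm_sub_sq_real, real_inner_smul_right, real_inner_comm] at h5
  have := sq_nonneg ‖γ • (f p - p)‖
  linarith

theorem norm_viscosity_sub_le {f : H → H} {k : NNReal} (hf : ContractingWith k f) {γ : ℝ}
    (hγ : γ ∈ Set.Ioo (0 : ℝ) 1) {p u w x' : H} (huw : ‖u - p‖ ≤ ‖w - p‖)
    (hx' : x' = (1 - γ) • u + γ • f w) :
    ‖x' - p‖ ≤ (1 - (1 - k) * γ) * ‖w - p‖ + γ * ‖f p - p‖ := by
  have h1 : x' - p = (1 - γ) • (u - p) + γ • (f w - f p) + γ • (f p - p) := by rw [hx']; module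
  have hfw := hf.2.dist_le_mul w p
  rw [dist_eq_norm, dist_eq_norm] at hfw
  rw [h1]
  refine (norm_add₃_le).trans ?_
  rw [norm_smul, norm_smul, norm_smul, Real.norm_of_nonneg (sub_nonneg.2 hγ.2.le),
    Real.norm_of_nonneg hγ.1.le]
  have h3 := mul_le_mul_of_nonneg_left huw (sub_nonneg.2 hγ.2.le)
  have h4 := mul_le_mul_of_nonneg_left hfw hγ.1.le
  linarith

/-- With `K = ‖f p - p‖`, the bound is `max ‖x 1 - p‖ ((max E 0 + K) / (1 - k))`. -/
theorem viscosity_bounded {f : H → H} {k : NNReal} (hf : ContractingWith k f) {p : H}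
    {γ ε : ℕ → ℝ} (hγ : ∀ n, 1 ≤ n → γ n ∈ Set.Ioo (0 : ℝ) 1) {E : ℝ} (hE : ∀ n, ε n ≤ E)
    {x u w : ℕ → H} (hw : ∀ n, 1 ≤ n → ‖w n - p‖ ≤ ‖x n - p‖ + ε n * γ n)
    (huw : ∀ n, 1 ≤ n → ‖u n - p‖ ≤ ‖w n - p‖)
    (hx : ∀ n, 1 ≤ n → x (n + 1) = (1 - γ n) • u n + γ n • f (w n)) :
    ∃ R, ∀ n, 1 ≤ n → ‖x n - p‖ ≤ R := by
  have hk : 0 < 1 - (k : ℝ) := sub_pos.2 hf.1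
  have hk0 : (0 : ℝ) ≤ k := k.2
  set E' := max E 0
  have hE' : ∀ n, ε n ≤ E' := fun n => (hE n).trans (le_max_left _ _)
  have hE0 : 0 ≤ E' := le_max_right _ _
  set R := max ‖x 1 - p‖ ((E' + ‖f p - p‖) / (1 - k)) with hR
  have hRge : E' + ‖f p - p‖ ≤ (1 - k) * R := by
    rw [mul_comm, ← div_le_iff₀ hk]; exact le_max_right _ _
  refine ⟨R, fun n hn => ?_⟩
  induction n, hn using Nat.le_induction with
  | base => exact le_max_left _ _
  | succ n hn ih =>
    have hγn := hγ n hn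
    have h1 := norm_viscosity_sub_le hf hγn (huw n hn) (hx n hn)
    have h2 : ‖w n - p‖ ≤ R + E' * γ n :=
      (hw n hn).trans (add_le_add ih (mul_le_mul_of_nonneg_right (hE' n) hγn.1.le))
    have hδ0 : 0 ≤ 1 - (1 - k) * γ n := by nlinarith [hγn.1, hγn.2]
    have h3 := mul_le_mul_of_nonneg_left h2 hδ0
    have h4 := mul_le_mul_of_nonneg_left hRge hγn.1.le
    have h5 : 0 ≤ (1 - k) * γ n * (E' * γ n) :=
      mul_nonneg (mul_nonneg hk.le hγn.1.le) (mul_nonneg hE0 hγn.1.le)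
    linarith

/-- Strong convergence of the viscosity iteration `x (n + 1) = (1 - γ n) T ω + γ n f ω`,
`ω = T v`, where the distance of `v n` from `p` exceeds that of `x n` by at most `ε n * γ n`. The
demiclosedness of `I - T n` enters only through `hdemi`. -/
theorem tendsto_of_viscosity [CompleteSpace H] {f : H → H} {k : NNReal} (hf : ContractingWith k f)
    {T : ℕ → H → H} {p : H} {c : ℕ → ℝ} {c' : ℝ} (hc : ∀ n, 1 ≤ n → 0 ≤ c n) (hc' : 0 < c')
    (hclim : Tendsto c atTop (𝓝 c'))
    (hT : ∀ n, 1 ≤ n → ∀ v, ‖T n v - p‖ ^ 2 ≤ ‖v - p‖ ^ 2 - c n * ‖v - T n v‖ ^ 2)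
    (hTne : ∀ n, 1 ≤ n → ∀ u v, ‖T n u - T n v‖ ≤ ‖u - v‖)
    (hdemi : ∀ U : Ultrafilter ℕ, ↑U ≤ (atTop : Filter ℕ) → ∀ (v : ℕ → H) (q : H) (C : ℝ),
      (∀ᶠ n in (U : Filter ℕ), ‖v n‖ ≤ C) →
      (∀ h, Tendsto (fun n => inner ℝ h (v n)) U (𝓝 (inner ℝ h q))) →
      Tendsto (fun n => v n - T n (v n)) U (𝓝 0) → inner ℝ (f p - p) (q - p) ≤ 0)
    {γ ε : ℕ → ℝ} (hγ : ∀ n, 1 ≤ n → γ n ∈ Set.Ioo (0 : ℝ) 1) (hε : ∀ n, 1 ≤ n → 0 < ε n)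
    (hγ_lim : Tendsto γ atTop (𝓝 0)) (hε_lim : Tendsto ε atTop (𝓝 0))
    (hγ_sum : Tendsto (fun N : ℕ => ∑ n ∈ Finset.Icc 1 N, γ n) atTop atTop)
    {x v : ℕ → H} (hv : ∀ n, 1 ≤ n → ‖v n - p‖ ≤ ‖x n - p‖ + ε n * γ n)
    (hx : ∀ n, 1 ≤ n → x (n + 1) = (1 - γ n) • T n (T n (v n)) + γ n • f (T n (v n))) :
    Tendsto x atTop (𝓝 p) := by
  have hk0 : (0 : ℝ) ≤ k := k.2
  obtain ⟨κ, hκ⟩ : ∃ κ, κ = 1 - (k : ℝ) := ⟨_, rfl⟩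
  have hκ0 : 0 < κ := hκ ▸ sub_pos.2 hf.1
  have hκ1 : κ ≤ 1 := by linarith
  obtain ⟨ω, hω⟩ : ∃ ω : ℕ → H, ∀ n, ω n = T n (v n) := ⟨_, fun _ => rfl⟩
  simp only [← hω] at hx
  have hTp : ∀ n, 1 ≤ n → ∀ w, ‖T n w - p‖ ≤ ‖w - p‖ := fun n hn w =>
    le_of_sq_le_sq ((hT n hn w).trans (sub_le_self _ (mul_nonneg (hc n hn) (sq_nonneg _))))
      (norm_nonneg _)
  have hωv : ∀ n, 1 ≤ n → ‖ω n - p‖ ≤ ‖v n - p‖ := fun n hn => hω n ▸ hTp n hn (v n)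
  obtain ⟨E, hE⟩ := hε_lim.bddAbove_range
  have hE : ∀ n, ε n ≤ E := fun n => hE ⟨n, rfl⟩
  have hE0 : 0 ≤ E := (hε 1 le_rfl).le.trans (hE 1)
  obtain ⟨R, hR⟩ := viscosity_bounded hf hγ hE (fun n hn => (hωv n hn).trans (hv n hn))
    (fun n hn => hTp n hn (ω n)) hx
  have hR0 : 0 ≤ R := (norm_nonneg _).trans (hR 1 le_rfl)
  have hvR : ∀ n, 1 ≤ n → ‖v n - p‖ ≤ R + E := fun n hn => by
    have h1 : ε n * γ n ≤ E * 1 :=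
      mul_le_mul (hE n) (hγ n hn).2.le (hγ n hn).1.le hE0
    linarith [hv n hn, hR n hn]
  obtain ⟨K, hK⟩ : ∃ K, K = ‖f p - p‖ := ⟨_, rfl⟩
  have hK0 : 0 ≤ K := hK ▸ norm_nonneg _
  obtain ⟨I, hI⟩ : ∃ I : ℕ → ℝ, ∀ n, I n = inner ℝ (f p - p) (x (n + 1) - p) := ⟨_, fun _ => rfl⟩
  have hIle : ∀ n, 1 ≤ n → I n ≤ K * R := fun n hn => by
    rw [hI, hK]
    exact (real_inner_le_norm _ _).trans
      (mul_le_mul_of_nonneg_left (hR (n + 1) (by omega)) (norm_nonneg _))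
  obtain ⟨δ, hδ⟩ : ∃ δ : ℕ → ℝ, ∀ n, δ n = κ * γ n := ⟨_, fun _ => rfl⟩
  have hδpos : ∀ n, 1 ≤ n → 0 < δ n := fun n hn => hδ n ▸ mul_pos hκ0 (hγ n hn).1
  have hδlt : ∀ n, 1 ≤ n → δ n < 1 := fun n hn => by
    rw [hδ]; nlinarith [(hγ n hn).1, (hγ n hn).2]
  have hδlim : Tendsto δ atTop (𝓝 0) := by
    rw [funext hδ]
    simpa using hγ_lim.const_mul κ
  obtain ⟨d, hd⟩ : ∃ d : ℕ → ℝ, ∀ n, d n = ‖v n - ω n‖ ^ 2 := ⟨_, fun _ => rfl⟩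
  have hd0 : ∀ n, 0 ≤ d n := fun n => hd n ▸ sq_nonneg _
  -- The forcing term without, and with, the gain from the residual `‖v n - ω n‖`.
  obtain ⟨b₀, hb₀⟩ : ∃ b₀ : ℕ → ℝ, ∀ n, b₀ n = (2 * R * ε n + ε n ^ 2 * γ n + 2 * I n) / κ :=
    ⟨_, fun _ => rfl⟩
  obtain ⟨b, hb⟩ : ∃ b : ℕ → ℝ, ∀ n, b n = b₀ n - (1 - δ n) * c n * d n / δ n := ⟨_, fun _ => rfl⟩
  have hrec : ∀ n, 1 ≤ n →
      ‖x (n + 1) - p‖ ^ 2 ≤ (1 - δ n) * ‖x n - p‖ ^ 2 + δ n * b n := by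
    intro n hn
    have h1 := norm_viscosity_sub_sq_le hf (hγ n hn) (hTp n hn (ω n)) (hx n hn)
    rw [← hκ, ← hδ, ← hI] at h1
    have h2 := hT n hn (v n)
    rw [← hω, ← hd] at h2
    have hεγ : 0 ≤ ε n * γ n := mul_nonneg (hε n hn).le (hγ n hn).1.le
    have h3 : ‖v n - p‖ ^ 2 ≤ ‖x n - p‖ ^ 2 + (2 * R * (ε n * γ n) + (ε n * γ n) ^ 2) := by
      have h4 := pow_le_pow_left₀ (norm_nonneg _) (hv n hn) 2
      have h5 := mul_le_mul_of_nonneg_right (hR n hn) hεγ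
      linarith
    have h6 : 0 ≤ 2 * R * (ε n * γ n) + (ε n * γ n) ^ 2 := by positivity
    have h7 := mul_le_mul_of_nonneg_left (h2.trans (sub_le_sub_right h3 _))
      (sub_nonneg.2 (hδlt n hn).le)
    have h8 := mul_nonneg (hδpos n hn).le h6
    have h9 : δ n * b n = 2 * R * (ε n * γ n) + (ε n * γ n) ^ 2 + 2 * γ n * I n
        - (1 - δ n) * c n * d n := by
      rw [hb, mul_sub, mul_div_cancel₀ _ (hδpos n hn).ne', hb₀, hδ]
      field_simp
    rw [h9]
    linarith
  have hsum : Tendsto (fun N : ℕ => ∑ n ∈ Finset.Icc 1 N, δ n) atTop atTop := by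
    simp only [hδ, ← Finset.mul_sum]
    exact hγ_sum.const_mul_atTop hκ0
  have hmain : ∀ e, 0 < e → ∀ᶠ n in atTop, b n ≤ e := by
    intro e he
    by_contra hcon
    rw [not_eventually] at hcon
    simp only [not_le] at hcon
    have hne := frequently_mem_iff_neBot.1 hcon
    obtain ⟨U, hU⟩ := @Ultrafilter.exists_le _ (atTop ⊓ 𝓟 {n | e < b n}) hne
    have hUtop : ↑U ≤ (atTop : Filter ℕ) := hU.trans inf_le_left
    have hUb : ∀ᶠ n in (U : Filter ℕ), e < b n := le_principal_iff.1 (hU.trans inf_le_right)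
    have hU1 : ∀ᶠ n in (U : Filter ℕ), 1 ≤ n := hUtop (eventually_ge_atTop 1)
    have hbb₀ : ∀ n, 1 ≤ n → b n ≤ b₀ n := fun n hn => by
      rw [hb]
      exact sub_le_self _ (div_nonneg (mul_nonneg (mul_nonneg (sub_nonneg.2 (hδlt n hn).le)
        (hc n hn)) (hd0 n)) (hδpos n hn).le)
    -- Where `b n > e`, the residual term is at most of the order of `δ n`, hence vanishes.
    obtain ⟨M, hM⟩ : ∃ M, M = (2 * R * E + E ^ 2 + 2 * (K * R)) / κ := ⟨_, rfl⟩
    have hb₀M : ∀ n, 1 ≤ n → b₀ n ≤ M := fun n hn => by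
      rw [hb₀, hM]
      have h1 := mul_le_mul_of_nonneg_left (hE n) (mul_nonneg two_pos.le hR0)
      have h2 : ε n ^ 2 * γ n ≤ E ^ 2 * 1 :=
        mul_le_mul (pow_le_pow_left₀ (hε n hn).le (hE n) 2) (hγ n hn).2.le (hγ n hn).1.le
          (sq_nonneg _)
      have h3 := hIle n hn
      exact div_le_div_of_nonneg_right (by linarith) hκ0.le
    have hclim' : Tendsto (fun n => (1 - δ n) * c n) U (𝓝 c') := by
      simpa using ((hδlim.const_sub 1).mul hclim).mono_left hUtop
    have hdle : ∀ᶠ n in (U : Filter ℕ), d n ≤ δ n * M / (c' / 2) := by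
      filter_upwards [hU1, hUb, hclim'.eventually (lt_mem_nhds (half_lt_self hc'))]
        with n hn hbn hcn
      rw [le_div_iff₀ (half_pos hc'), mul_comm (d n)]
      refine (mul_le_mul_of_nonneg_right hcn.le (hd0 n)).trans ?_
      rw [mul_comm (δ n), ← div_le_iff₀ (hδpos n hn)]
      rw [hb] at hbn
      linarith [hb₀M n hn]
    have hdlim : Tendsto d U (𝓝 0) := by
      refine squeeze_zero' (Eventually.of_forall hd0) hdle ?_
      simpa using ((hδlim.mono_left hUtop).mul_const M).div_const (c' / 2)
    have hnlim : Tendsto (fun n => ‖v n - ω n‖) U (𝓝 0) := by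
      have := hdlim.sqrt
      simpa [hd, Real.sqrt_sq (norm_nonneg _)] using this
    have hCv : ∀ᶠ n in (U : Filter ℕ), ‖v n‖ ≤ R + E + ‖p‖ := by
      filter_upwards [hU1] with n hn
      have := norm_le_norm_sub_add (v n) p
      linarith [hvR n hn]
    obtain ⟨q, hq⟩ := exists_tendsto_inner_ultrafilter U hCv
    have hqle := hdemi U hUtop v q _ hCv hq (by
      simp only [← hω]
      exact tendsto_zero_iff_norm_tendsto_zero.2 hnlim)
    have hxv : Tendsto (fun n => x (n + 1) - v n) U (𝓝 0) := by
      refine squeeze_zero_norm'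
        (a := fun n => 2 * ‖v n - ω n‖ + γ n * (2 * (R + E) + K)) ?_ ?_
      · filter_upwards [hU1] with n hn
        have h1 : x (n + 1) - v n = (T n (ω n) - ω n) - (v n - ω n)
            + γ n • ((f (ω n) - f p) + (f p - p) - (T n (ω n) - p)) := by
          rw [hx n hn]; module
        have h2 : ‖T n (ω n) - ω n‖ ≤ ‖v n - ω n‖ := by
          have := hTne n hn (ω n) (v n)
          rwa [← hω, norm_sub_rev (ω n) (v n)] at this
        have h3 : ‖f (ω n) - f p‖ ≤ R + E := by
          have h4 := hf.2.dist_le_mul (ω n) p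
          rw [dist_eq_norm, dist_eq_norm] at h4
          have h6 := mul_le_mul_of_nonneg_right (NNReal.coe_lt_one.2 hf.1).le
            (norm_nonneg (ω n - p))
          linarith [hωv n hn, hvR n hn]
        have h7 : ‖T n (ω n) - p‖ ≤ R + E := by
          linarith [hTp n hn (ω n), hωv n hn, hvR n hn]
        rw [h1]
        refine (norm_add_le _ _).trans (add_le_add ?_ ?_)
        · linarith [norm_sub_le (T n (ω n) - ω n) (v n - ω n)]
        · rw [norm_smul, Real.norm_of_nonneg (hγ n hn).1.le]
          refine mul_le_mul_of_nonneg_left ?_ (hγ n hn).1.le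
          refine (norm_sub_le _ _).trans ?_
          have := norm_add_le (f (ω n) - f p) (f p - p)
          rw [← hK] at this
          linarith
      · simpa using (hnlim.const_mul 2).add
          ((hγ_lim.mono_left hUtop).mul_const (2 * (R + E) + K))
    have hIlim : Tendsto I U (𝓝 (inner ℝ (f p - p) (q - p))) := by
      have h1 : Tendsto (fun n => inner ℝ (f p - p) (x (n + 1) - v n)) U (𝓝 0) := by
        simpa using (tendsto_const_nhds (x := f p - p)).inner hxv (𝕜 := ℝ)
      have h2 := (h1.add (hq (f p - p))).sub_const (inner ℝ (f p - p) p)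
      rw [zero_add, ← inner_sub_right] at h2
      refine h2.congr fun n => ?_
      rw [hI, ← inner_add_right, ← inner_sub_right, sub_add_cancel]
    have hb₀lim : Tendsto b₀ U (𝓝 (2 * inner ℝ (f p - p) (q - p) / κ)) := by
      rw [funext hb₀]
      have h1 := hε_lim.mono_left hUtop
      have h2 := (((h1.const_mul (2 * R)).add ((h1.pow 2).mul (hγ_lim.mono_left hUtop))).add
        (hIlim.const_mul 2)).div_const κ
      simpa using h2
    have hle : e ≤ 2 * inner ℝ (f p - p) (q - p) / κ := by
      refine ge_of_tendsto hb₀lim ?_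
      filter_upwards [hU1, hUb] with n hn hbn using hbn.le.trans (hbb₀ n hn)
    have : 2 * inner ℝ (f p - p) (q - p) / κ ≤ 0 :=
      div_nonpos_of_nonpos_of_nonneg (by linarith) hκ0.le
    linarith
  have hs := tendsto_zero_of_le_one_sub_mul_add (fun n => sq_nonneg ‖x n - p‖)
    (fun n hn => ⟨(hδpos n hn).le, (hδlt n hn).le⟩) hsum hrec hmain
  rw [tendsto_iff_norm_sub_tendsto_zero]
  simpa [Real.sqrt_sq (norm_nonneg _)] using hs.sqrt

/-! ### The inertial forward-backward iteration -/

theorem norm_convexCombo_sub_le {p u w : H} {t r : ℝ} (ht : t ∈ Set.Ioo (0 : ℝ) 1)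
    (hu : ‖u - p‖ ≤ r) (hw : ‖w - p‖ ≤ r) : ‖(1 - t) • u + t • w - p‖ ≤ r := by
  have h : Convex ℝ (Metric.closedBall p r) := convex_closedBall p r
  have := h (mem_closedBall_iff_norm.2 hu) (mem_closedBall_iff_norm.2 hw)
    (sub_nonneg.2 ht.2.le) ht.1.le (sub_add_cancel 1 t)
  exact mem_closedBall_iff_norm.1 this

end MonotoneInclusion

theorem mainTheorem2 {H : Type*} [NormedAddCommGroup H] [InnerProductSpace ℝ H] [CompleteSpace H]
    (f : H → H) (k : NNReal) (hf : ContractingWith k f)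
    (A : H → H) (η : ℝ) (hA : MonotoneInclusion.IsInverseStronglyMonotone η A)
    (B : H → Set H) (hB : MonotoneInclusion.IsMaximalMonotoneOp B)
    (hΩ : (MonotoneInclusion.zeros (MonotoneInclusion.opAdd A B)).Nonempty)
    (lam : ℕ → ℝ) (lam' : ℝ)
    (hlam : ∀ n, 1 ≤ n → lam n ∈ Set.Ioo 0 (2 * η))
    (hlam' : lam' ∈ Set.Ioo 0 (2 * η))
    (hlam_lim : Tendsto lam atTop (𝓝 lam'))
    (θ : ℝ) (hθ : 0 ≤ θ)
    (ε α β γ : ℕ → ℝ)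
    (hε : ∀ n, 1 ≤ n → 0 < ε n)
    (hα : ∀ n, 1 ≤ n → α n ∈ Set.Ioo 0 1)
    (hβ : ∀ n, 1 ≤ n → β n ∈ Set.Ioo 0 1)
    (hγ : ∀ n, 1 ≤ n → γ n ∈ Set.Ioo 0 1)
    (a a' : ℝ) (ha : 0 < a) (ha' : a' < 1)
    (hα_bd : ∀ n, 1 ≤ n → a ≤ α n ∧ α n < a')
    (hε_lim : Tendsto ε atTop (𝓝 0))
    (hγ_lim : Tendsto γ atTop (𝓝 0))
    (hγ_sum : Tendsto (fun N : ℕ => ∑ n ∈ Finset.Icc 1 N, γ n) atTop atTop)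
    (x z y ω : ℕ → H)
    (hz : ∀ n, 1 ≤ n →
      z n = x n + MonotoneInclusion.inertialParam θ (ε n * γ n) (x n) (x (n - 1))
        • (x n - x (n - 1)))
    (hy : ∀ n, 1 ≤ n →
      y n = (1 - β n) • z n + β n • MonotoneInclusion.forwardBackward A B (lam n) (z n))
    (hω : ∀ n, 1 ≤ n →
      ω n = MonotoneInclusion.forwardBackward A B (lam n)
        ((1 - α n) • MonotoneInclusion.forwardBackward A B (lam n) (x n)
          + α n • MonotoneInclusion.forwardBackward A B (lam n) (y n)))
    (hx : ∀ n, 1 ≤ n →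
      x (n + 1) = (1 - γ n) • MonotoneInclusion.forwardBackward A B (lam n) (ω n)
        + γ n • f (ω n)) :
    ∃ xs ∈ MonotoneInclusion.zeros (MonotoneInclusion.opAdd A B),
      MonotoneInclusion.IsMetricProjection
        (MonotoneInclusion.zeros (MonotoneInclusion.opAdd A B)) (f xs) xs ∧
      Tendsto x atTop (𝓝 xs) := by
  have hη := hA.1
  obtain ⟨p, hpΩ, hproj, hvar⟩ := MonotoneInclusion.exists_isMetricProjection_fixed hf hΩ
    (MonotoneInclusion.convex_zeros_opAdd hA hB) (MonotoneInclusion.isClosed_zeros_opAdd hA hB)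
  refine ⟨p, hpΩ, hproj, ?_⟩
  have hfix : ∀ n, 1 ≤ n → MonotoneInclusion.forwardBackward A B (lam n) p = p := fun n hn =>
    MonotoneInclusion.forwardBackward_eq_self hB (hlam n hn).1 hpΩ
  have hne : ∀ n, 1 ≤ n → ∀ u v, ‖MonotoneInclusion.forwardBackward A B (lam n) u
      - MonotoneInclusion.forwardBackward A B (lam n) v‖ ≤ ‖u - v‖ := fun n hn =>
    MonotoneInclusion.norm_forwardBackward_sub_le hA hB (hlam n hn).1 (hlam n hn).2
  have hnep : ∀ n, 1 ≤ n → ∀ u,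
      ‖MonotoneInclusion.forwardBackward A B (lam n) u - p‖ ≤ ‖u - p‖ := fun n hn u => by
    have := hne n hn u p
    rwa [hfix n hn] at this
  refine MonotoneInclusion.tendsto_of_viscosity (v := fun n =>
      (1 - α n) • MonotoneInclusion.forwardBackward A B (lam n) (x n)
        + α n • MonotoneInclusion.forwardBackward A B (lam n) (y n))
    (T := fun n => MonotoneInclusion.forwardBackward A B (lam n))
    (c := fun n => (2 * η - lam n) / (4 * η)) (c' := (2 * η - lam') / (4 * η))
    hf (fun n hn => ?_) ?_ ?_ (fun n hn v => ?_) hne ?_ hγ hε hγ_lim hε_lim hγ_sum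
    (fun n hn => ?_) (fun n hn => ?_)
  · exact div_nonneg (sub_nonneg.2 (hlam n hn).2.le) (by linarith)
  · exact div_pos (sub_pos.2 hlam'.2) (by linarith)
  · exact (hlam_lim.const_sub _).div_const _
  · have := MonotoneInclusion.norm_forwardBackward_sub_sq_le hA hB (hlam n hn).1 (hlam n hn).2 v p
    rwa [hfix n hn, sub_self, sub_zero] at this
  · intro U hU v q C hC hweak hres
    refine hvar q (MonotoneInclusion.mem_zeros_of_tendsto_weak hA hB (r := lam) ?_ hlam'.1
      (hlam_lim.mono_left hU) hC hweak hres)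
    filter_upwards [hU (eventually_ge_atTop 1)] with n hn using (hlam n hn).1
  · have hεγ : 0 ≤ ε n * γ n := mul_nonneg (hε n hn).le (hγ n hn).1.le
    have hzp : ‖z n - p‖ ≤ ‖x n - p‖ + ε n * γ n := by
      rw [hz n hn, add_sub_right_comm]
      exact (norm_add_le _ _).trans
        (add_le_add_right (MonotoneInclusion.norm_inertialParam_smul_le hθ hεγ _ _) _)
    have hyp : ‖y n - p‖ ≤ ‖x n - p‖ + ε n * γ n := by
      rw [hy n hn]
      exact MonotoneInclusion.norm_convexCombo_sub_le (hβ n hn) hzp ((hnep n hn _).trans hzp)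
    exact MonotoneInclusion.norm_convexCombo_sub_le (hα n hn)
      ((hnep n hn _).trans (le_add_of_nonneg_right hεγ)) ((hnep n hn _).trans hyp)
  · have := hx n hn
    rwa [hω n hn] at this
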